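/- Let $(D,K)$ be a limit sketch: $D$ is a small category and $K$ is a small set of cones $c$, each given by a category $\mathtt{A}_c$ (assumed finite), a functor $\mathtt{in}(c):\mathtt{A}_c\to D$, an object $\mathtt{ou}(c)$ of $D$ and a natural transformation $\rho:\Delta(\mathtt{ou}(c))\Rightarrow \mathtt{in}(c)$. For $X\in\mathbf{Set}^D$ write $X[c]=\lim X\circ\mathtt{in}(c)$, with projections $\mathrm{proj}_z:X[c]\to X(\mathtt{in}(c)(z))$. A *model* is a functor $M:D\to\mathbf{Set}$ sending every cone of $K$ to a limit cone. A *reflector* of $X$ is an arrow $X\to Q$ with $Q$ a model through which every arrow from $X$ to a model factors uniquely. For $c\in K$ let $i_c:X\to P_c(X)$ be Kelly's arrow, where $$P_c(X)(d)=\bigl(X(d)+D(\mathtt{ou}(c),d)\times X[c]\bigr)/\!\sim$$ with $\sim$ generated by $(t,(X(\rho_z)(a))_z)\sim X(t)(a)$ for $t:\mathtt{ou}(c)\to d$, $a\in X(\mathtt{ou}(c))$, and $(t\circ\rho_z,s)\sim X(t)(\mathrm{proj}_z(s))$ for $z\in\mathtt{A}_c$, $t:\mathtt{in}(c)(z)\to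 d$, $s\in X[c]$. Let $P(X)$ be the wide pushout of all the $i_c$, with canonical maps $i:X\to P(X)$ and $j_c:P_c(X)\to P(X)$. **Theorem.** There exist, functorially in $X\in\mathbf{Set}^D$, objects $B_i(X),E_i(X)$ for $i\in\omega$ and, naturally in $X$, epimorphisms $p_i:S_i\to B_{i+1}(X)$, where $S_i=B_i(X)+E_i(X)$, such that: - $B_0(X)= X$ and $E_0(X)=\emptyset$ (so $S_0\cong X$). - $E_{i+1}(X)$, with a unit $a_i:S_i[c]\to E_{i+1}(X)(\mathtt{ou}(c))$ natural in $X$, is the left Kan extension of $c\mapsto S_i[c]$ along $\mathtt{ou}:K\to D$, where $K$ is viewed as a discrete category. - $p_i$ is the quotient map which, at each object $d$, has as kernel the equivalence relation on $S_i(d)$ generated by the following pairs. - (1) Pairs $x,y\in S_i(d)$ for which there are $c\in K$ and $t:\mathtt{ou}(c)\to d$ such that $x$ and $y$ become equal in the pushout of the canonical arrow $S_i(\mathtt{ou}(c))\to S_i[c]$ along $S_i(t):S_i(\mathtt{ou}(c))\to S_i(d)$. - (2) If $i\ge 1$: pairs $x\in E_i(X)(d)$, $y\in B_i(X)(d)$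 for which there are $c\in K$, $z\in\mathtt{A}_c$, $t:\mathtt{in}(c)(z)\to d$ and $s\in S_{i-1}[c]$ such that $$x=E_i(X)(t)\bigl(E_i(X)(\rho_z)(a_{i-1}(s))\bigr)\quad\text{and}\quad y=p_{i-1}\bigl(S_{i-1}(t)(\mathrm{proj}_z(s))\bigr).$$ - The reflector of $X$ is the transfinite composite $X\cong S_0\to\operatorname{colim}_i S_i$ of the sequence $S_0\to S_1\to S_2\to\cdots$ whose arrows are $S_i\xrightarrow{p_i}B_{i+1}(X)\hookrightarrow S_{i+1}$. - There are maps $\alpha_i:S_i\to P^i(X)$, natural in $X$, forming a transformation from this sequence to Kelly's sequence $X\xrightarrow{i}P(X)\xrightarrow{P(i)}P^2(X)\to\cdots$, with $\alpha_0$ the identity of $X$. Moreover, for $n>1$ and $c\in K$, suppose that $u:P^{n-1}(X)\to S_{n-1}$ and $v:P_cP^{n-1}(X)\to S_n$ satisfy $\alpha_{n-1}u=\mathrm{id}$, $\alpha_n v=j_c$, and $v\,i_c$ equals the composite of $u$ with $S_{n-1}\to S_n$. Then $v$ factors through $B_n(X)\hookrightarrow S_n$. -/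

import Mathlib

open CategoryTheory CategoryTheory.Limits

universe w

/-- A limit sketch `(D, K)`: a small category `D` with a small set `K` of chosen cones in `D`,
given as a family. The cone `c` has shape `Shape c`, base `diag c` (written `in(c)`), vertex
`ou(c)` and legs `ρ_z : ou(c) ⟶ in(c)(z)`. -/
structure LimitSketch (D : Type w) [SmallCategory.{w} D] where
  K : Type w
  Shape : K → Type w
  [shapeCategory : ∀ c, SmallCategory.{w} (Shape c)]
  diag : ∀ c, Shape c ⥤ D
  cone : ∀ c, Cone (diag c)

attribute [instance] LimitSketch.shapeCategory

namespace LimitSketch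

variable {D : Type w} [SmallCategory.{w} D] (T : LimitSketch.{w} D)

/-- The vertex `ou(c)` of the cone `c`. -/
abbrev ou (c : T.K) : D := (T.cone c).pt

/-- The leg `ρ_z : ou(c) ⟶ in(c)(z)` of the cone `c`. -/
abbrev leg (c : T.K) (z : T.Shape c) : T.ou c ⟶ (T.diag c).obj z := (T.cone c).π.app z

/-- `X` is a model if it sends every chosen cone to a limit cone. -/
def IsModel (X : D ⥤ Type w) : Prop :=
  ∀ c : T.K, Nonempty (IsLimit (X.mapCone (T.cone c)))

/-- `η : X ⟶ Q` is the reflector of `X` into models: `Q` is a model and every map from `X` to a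
model factors uniquely through `η`. -/
def IsReflector {X Q : D ⥤ Type w} (η : X ⟶ Q) : Prop :=
  T.IsModel Q ∧ ∀ M : D ⥤ Type w, T.IsModel M → ∀ f : X ⟶ M, ∃! g : Q ⟶ M, η ≫ g = f

/-- The functor `X ↦ X[c] = lim (X ∘ in(c))`. -/
noncomputable def lim (c : T.K) : (D ⥤ Type w) ⥤ Type w :=
  (Functor.whiskeringLeft _ _ (Type w)).obj (T.diag c) ⋙ Limits.lim

/-- The projection `proj_z : X[c] ⟶ X(in(c)(z))`. -/
noncomputable def proj (c : T.K) (z : T.Shape c) (X : D ⥤ Type w) :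
    (T.lim c).obj X ⟶ X.obj ((T.diag c).obj z) :=
  limit.π (T.diag c ⋙ X) z

/-- The canonical arrow `X(ou(c)) ⟶ X[c]`. -/
noncomputable def canon (c : T.K) (X : D ⥤ Type w) : X.obj (T.ou c) ⟶ (T.lim c).obj X :=
  limit.lift (T.diag c ⋙ X) (X.mapCone (T.cone c))

theorem canon_naturality (c : T.K) {X Y : D ⥤ Type w} (f : X ⟶ Y) :
    f.app (T.ou c) ≫ T.canon c Y = T.canon c X ≫ (T.lim c).map f := by
  apply limit.hom_ext
  intro z
  simp [canon, lim]

theorem proj_naturality (c : T.K) (z : T.Shape c) {X Y : D ⥤ Type w} (f : X ⟶ Y) :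
    (T.lim c).map f ≫ T.proj c z Y = T.proj c z X ≫ f.app ((T.diag c).obj z) := by
  simp [proj, lim]

/-! ### Kelly's construction -/

/-- The relation on `X(d) + D(ou(c), d) × X[c]` identifying the images of the two legs of Kelly's
span `D(ou(c), d) × X(ou(c)) + colim_z D(in(c)(z), d) × X[c]`. -/
inductive KellyRel (c : T.K) (X : D ⥤ Type w) (d : D) :
    X.obj d ⊕ ((T.ou c ⟶ d) × (T.lim c).obj X) →
      X.obj d ⊕ ((T.ou c ⟶ d) × (T.lim c).obj X) → Prop
  | vertex (t : T.ou c ⟶ d) (x : X.obj (T.ou c)) :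
      KellyRel c X d (Sum.inr (t, T.canon c X x)) (Sum.inl (X.map t x))
  | base (z : T.Shape c) (t : (T.diag c).obj z ⟶ d) (s : (T.lim c).obj X) :
      KellyRel c X d (Sum.inr (T.leg c z ≫ t, s)) (Sum.inl (X.map t (T.proj c z X s)))

/-- `P_c(X)`, the pushout of Kelly's span, computed pointwise as a quotient of
`X(d) + D(ou(c), d) × X[c]`. -/
noncomputable def kellyConeObj (c : T.K) (X : D ⥤ Type w) : D ⥤ Type w where
  obj d := Quot (T.KellyRel c X d)
  map {d d'} r := TypeCat.ofHom (Quot.map (Sum.map (X.map r) (Prod.map (fun t => t ≫ r) id)) (by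
    rintro _ _ (⟨t, x⟩ | ⟨z, t, s⟩)
    · simpa using KellyRel.vertex (T := T) (c := c) (t ≫ r) x
    · simpa using KellyRel.base (T := T) (c := c) z (t ≫ r) s))
  map_id d := by
    ext x
    induction x using Quot.ind with
    | mk x => rcases x with x | ⟨t, s⟩ <;> simp [Quot.map]
  map_comp r r' := by
    ext x
    induction x using Quot.ind with
    | mk x => rcases x with x | ⟨t, s⟩ <;> simp [Quot.map]

/-- The endofunctor `P_c`. -/
noncomputable def kellyCone (c : T.K) : (D ⥤ Type w) ⥤ (D ⥤ Type w) where
  obj X := T.kellyConeObj c X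
  map {X Y} f :=
    { app := fun d => TypeCat.ofHom
        (Quot.map (Sum.map (f.app d) (Prod.map id ((T.lim c).map f))) (by
          rintro _ _ (⟨t, x⟩ | ⟨z, t, s⟩)
          · have h := ConcreteCategory.congr_hom (T.canon_naturality c f) x
            have h' := ConcreteCategory.congr_hom (f.naturality t) x
            simp only [ConcreteCategory.comp_apply] at h h'
            simpa [← h, h'] using KellyRel.vertex (T := T) (c := c) t (f.app _ x)
          · have h := ConcreteCategory.congr_hom (T.proj_naturality c z f) s
            have h' := ConcreteCategory.congr_hom (f.naturality t) (T.proj c z X s)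
            simp only [ConcreteCategory.comp_apply] at h h'
            simpa [h, h'] using KellyRel.base (T := T) (c := c) z t ((T.lim c).map f s)))
      naturality := by
        intro d d' r
        ext x
        induction x using Quot.ind with
        | mk x => rcases x with x | ⟨t, s⟩ <;> simp [Quot.map, kellyConeObj] }
  map_id X := by
    ext d x
    induction x using Quot.ind with
    | mk x => rcases x with x | ⟨t, s⟩ <;> simp [Quot.map, kellyConeObj]
  map_comp f g := by
    ext d x
    induction x using Quot.ind with
    | mk x => rcases x with x | ⟨t, s⟩ <;> simp [Quot.map, kellyConeObj]

/-- The natural transformation `i_c : X ⟶ P_c(X)`. -/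
noncomputable def kellyConeUnit (c : T.K) : 𝟭 (D ⥤ Type w) ⟶ T.kellyCone c where
  app X :=
    { app := fun d => TypeCat.ofHom (fun x => Quot.mk (T.KellyRel c X d) (Sum.inl x))
      naturality := by
        intro d d' r
        ext x
        simp [kellyCone, kellyConeObj, Quot.map] }
  naturality X Y f := by
    ext d x
    rfl

/-- Kelly's endofunctor `P`: the wide pushout of the arrows `i_c`, for all chosen cones `c`. -/
noncomputable def kelly : (D ⥤ Type w) ⥤ (D ⥤ Type w) :=
  widePushout (𝟭 (D ⥤ Type w)) T.kellyCone T.kellyConeUnit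

/-- The natural transformation `i : X ⟶ P(X)`. -/
noncomputable def kellyUnit : 𝟭 (D ⥤ Type w) ⟶ T.kelly :=
  WidePushout.head T.kellyConeUnit

/-- The natural transformation `j_c : P_c(X) ⟶ P(X)`. -/
noncomputable def kellyIncl (c : T.K) : T.kellyCone c ⟶ T.kelly :=
  WidePushout.ι T.kellyConeUnit c

/-- The iterate `P^n`. -/
noncomputable def kellyPow : ℕ → (D ⥤ Type w) ⥤ (D ⥤ Type w)
  | 0 => 𝟭 _
  | n + 1 => kellyPow n ⋙ T.kelly

/-- The natural transformation `P^n(i) : P^n(X) ⟶ P^(n+1)(X)`. -/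
noncomputable def kellyStep : ∀ n : ℕ, T.kellyPow n ⟶ T.kellyPow (n + 1)
  | 0 => T.kellyUnit
  | n + 1 => Functor.whiskerRight (kellyStep n) T.kelly

/-! ### Elimination of quotients -/

/-- The data of an elimination of quotients, functorially in the presentation `X`: objects
`B_i(X)` and `E_i(X)` with maps to an object `S_i(X)` (meant to be their coproduct), maps
`p_i : S_i(X) ⟶ B_{i+1}(X)`, maps `a_i : S_i(X)[c] ⟶ E_{i+1}(X)(ou(c))`, and an identification
of `B_0(X)` with `X`. No law is imposed here apart from naturality in `X`. -/
structure EliminationData where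
  B : ℕ → (D ⥤ Type w) ⥤ (D ⥤ Type w)
  E : ℕ → (D ⥤ Type w) ⥤ (D ⥤ Type w)
  S : ℕ → (D ⥤ Type w) ⥤ (D ⥤ Type w)
  inl : ∀ i, B i ⟶ S i
  inr : ∀ i, E i ⟶ S i
  p : ∀ i, S i ⟶ B (i + 1)
  a : ∀ i (c : T.K), S i ⋙ T.lim c ⟶ E (i + 1) ⋙ (evaluation D (Type w)).obj (T.ou c)
  zeroIso : B 0 ≅ 𝟭 (D ⥤ Type w)

/-- The functor `ou : K ⥤ D` on the discrete category `K`. -/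
abbrev ouFunctor : Discrete T.K ⥤ D := Discrete.functor T.ou

/-- The functor `c ↦ X[c]` on the discrete category `K`. -/
noncomputable abbrev limFunctor (X : D ⥤ Type w) : Discrete T.K ⥤ Type w :=
  Discrete.functor (fun c => (T.lim c).obj X)

/-- First relation on `X(d)`: `x` and `y` become equal in the pushout of `X(ou(c)) ⟶ X[c]` along
`X(t) : X(ou(c)) ⟶ X(d)`, for some chosen cone `c` and some `t : ou(c) ⟶ d`. -/
def Identifies₁ (X : D ⥤ Type w) (d : D) (x y : X.obj d) : Prop :=
  ∃ (c : T.K) (t : T.ou c ⟶ d),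
    (pushout.inr (T.canon c X) (X.map t) : X.obj d ⟶ _) x =
      (pushout.inr (T.canon c X) (X.map t) : X.obj d ⟶ _) y

namespace EliminationData

variable {T} (Z : T.EliminationData)

/-- The map `X ≅ B_0(X) ⟶ S_0(X)`. -/
def unit : 𝟭 (D ⥤ Type w) ⟶ Z.S 0 := Z.zeroIso.inv ≫ Z.inl 0

/-- The map `S_i(X) ⟶ B_{i+1}(X) ⟶ S_{i+1}(X)`. -/
def step (i : ℕ) : Z.S i ⟶ Z.S (i + 1) := Z.p i ≫ Z.inl (i + 1)

/-- The sequence `S_0(X) ⟶ S_1(X) ⟶ S_2(X) ⟶ ⋯`. -/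
def chain (X : D ⥤ Type w) : ℕ ⥤ (D ⥤ Type w) :=
  Functor.ofSequence (fun i => (Z.step i).app X)

/-- The maps `a_i`, as a natural transformation over the discrete category `K`. -/
noncomputable def kanUnit (i : ℕ) (X : D ⥤ Type w) :
    T.limFunctor ((Z.S i).obj X) ⟶ T.ouFunctor ⋙ (Z.E (i + 1)).obj X :=
  Discrete.natTrans (fun c => (Z.a i c.as).app X)

/-- Second relation on `S_i(X)(d)`: `x` lies in `E_i(X)(d)`, `y` lies in `B_i(X)(d)`, and for some
chosen cone `c`, object `z` of its shape and `t : in(c)(z) ⟶ d`, they are the images of a common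
element `s` of `S_{i-1}(X)[c]` under `E_i(X)(t) ∘ E_i(X)(ρ_z) ∘ a_{i-1}` and
`p_{i-1} ∘ S_{i-1}(X)(t) ∘ proj_z`. It is empty for `i = 0`. -/
def Identifies₂ : ∀ (i : ℕ) (X : D ⥤ Type w) (d : D), ((Z.S i).obj X).obj d →
    ((Z.S i).obj X).obj d → Prop
  | 0, _, _, _, _ => False
  | i + 1, X, d, x, y =>
    ∃ (c : T.K) (z : T.Shape c) (t : (T.diag c).obj z ⟶ d) (s : (T.lim c).obj ((Z.S i).obj X)),
      x = ((Z.inr (i + 1)).app X).app d (((Z.E (i + 1)).obj X).map t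
        (((Z.E (i + 1)).obj X).map (T.leg c z) ((Z.a i c).app X s))) ∧
      y = ((Z.inl (i + 1)).app X).app d (((Z.p i).app X).app d
        (((Z.S i).obj X).map t (T.proj c z ((Z.S i).obj X) s)))

/-- The union of the two relations on `S_i(X)(d)`. -/
def Identifies (i : ℕ) (X : D ⥤ Type w) (d : D) (x y : ((Z.S i).obj X).obj d) : Prop :=
  T.Identifies₁ ((Z.S i).obj X) d x y ∨ Z.Identifies₂ i X d x y

end EliminationData

end LimitSketch

/-!
Say that a map `f : X ⟶ Y` of presheaves has a *filling* if there are maps `X[c] ⟶ Y(ou(c))`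
which agree with `f` on `X(ou(c))` and whose restrictions along the legs are the images under `f` of
the projections. Everything rests on three properties of this notion.

* A map with a filling respects the first relation, and a colimit of a sequence in which every stage
  admits a filling to a later one is a model, because finite limits commute with sequential
  colimits (`Filling.app_eq`, `isModel_of_isColimit`).
* A map from a stage `S` that respects the inherited second relation extends to the next stage as
  soon as it has a filling, and the extension respects the new second relation (`Stage.desc`,
  `Stage.desc_eq_of_rel`). Maps to models and Kelly's unit `i` have fillings; this gives the
  factorizations through the colimit and the comparison `α` with Kelly's sequence.
* The composite of three steps of the sequence has a filling (`Stage.filling`). The second relation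
  gives the element of `E_{i+1}` attached to `s ∈ S_i[c]` its coordinates one step later. Kelly's
  relation `(t, canon(x)) ∼ X(t)(x)` is not imposed by the construction, but follows from
  this: the two elements have the same coordinates, so the first relation identifies them after one
  further step.

The new elements of a stage are determined by their coordinates once mapped to a model, which gives
uniqueness of the factorization (`Stage.hom_ext_of_isModel`). Kelly's sequence uses `P^n(i)`
where the extension property yields `i` at `P^n(X)`; the two agree because `(P, i)` is well-pointed
(`kelly_wellPointed`).

For the last clause, an element of `P_c(Y)` attached to `s ∈ Y[c]` restricts along any leg of `c` to
an element of `Y`, whose image lies in `B`; as `B` and `E` are disjoint subfunctors of `S`, the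
element itself goes to `B`. When `c` has no legs, the element comes from `Y(ou(c))`, which is
inhabited for `Y = P^n(X)` with `n ≥ 1` (`exists_factor_inl`).
-/

namespace LimitSketch

variable {D : Type w} [SmallCategory.{w} D] (T : LimitSketch.{w} D)

/-! ### Elements of `X[c]` and fillings -/

section lim

variable {T} {c : T.K} {X Y : D ⥤ Type w}

theorem lim_ext {s s' : (T.lim c).obj X} (h : ∀ z, T.proj c z X s = T.proj c z X s') : s = s' :=
  Types.limit_ext (T.diag c ⋙ X) s s' h

theorem exists_proj_eq (x : ∀ z, X.obj ((T.diag c).obj z))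
    (h : ∀ z z' (f : z ⟶ z'), X.map ((T.diag c).map f) (x z) = x z') :
    ∃ s : (T.lim c).obj X, ∀ z, T.proj c z X s = x z :=
  ⟨Types.Limit.mk (T.diag c ⋙ X) x h, fun z => Types.Limit.π_mk (T.diag c ⋙ X) x h z⟩

theorem map_proj {z z' : T.Shape c} (f : z ⟶ z') (s : (T.lim c).obj X) :
    X.map ((T.diag c).map f) (T.proj c z X s) = T.proj c z' X s :=
  ConcreteCategory.congr_hom (limit.w (T.diag c ⋙ X) f) s

theorem proj_canon (z : T.Shape c) (x : X.obj (T.ou c)) :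
    T.proj c z X (T.canon c X x) = X.map (T.leg c z) x :=
  ConcreteCategory.congr_hom (limit.lift_π (X.mapCone (T.cone c)) z) x

theorem proj_lim_map (z : T.Shape c) (f : X ⟶ Y) (s : (T.lim c).obj X) :
    T.proj c z Y ((T.lim c).map f s) = f.app _ (T.proj c z X s) :=
  ConcreteCategory.congr_hom (T.proj_naturality c z f) s

theorem canon_app (f : X ⟶ Y) (x : X.obj (T.ou c)) :
    T.canon c Y (f.app _ x) = (T.lim c).map f (T.canon c X x) :=
  ConcreteCategory.congr_hom (T.canon_naturality c f) x

variable (T) in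
theorem isModel_iff (X : D ⥤ Type w) :
    T.IsModel X ↔ ∀ c : T.K, Function.Bijective (T.canon c X) :=
  forall_congr' fun c => by
    rw [IsLimit.nonempty_isLimit_iff_isIso_lift (limit.isLimit (T.diag c ⋙ X)),
      ← isIso_iff_bijective]
    rfl

end lim

/-- A filling of `f : X ⟶ Y` assigns to every element of `X[c]` an element of `Y(ou(c))` that has the
coordinates prescribed by `f`, compatibly with the elements of `X(ou(c))`. This amounts to an
extension of `f` to Kelly's `P(X)`, but is phrased without quotients. -/
structure Filling {X Y : D ⥤ Type w} (f : X ⟶ Y) where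
  fill : ∀ c : T.K, (T.lim c).obj X ⟶ Y.obj (T.ou c)
  canon_fill : ∀ (c : T.K) (x : X.obj (T.ou c)), fill c (T.canon c X x) = f.app _ x
  leg_fill : ∀ (c : T.K) (z : T.Shape c) (s : (T.lim c).obj X),
    Y.map (T.leg c z) (fill c s) = f.app _ (T.proj c z X s)

variable {T}

namespace Filling

variable {X Y : D ⥤ Type w}

/-- Precomposition of a filling with a map. -/
@[simps]
noncomputable def precomp {W : D ⥤ Type w} {f : X ⟶ Y} (φ : T.Filling f) (h : W ⟶ X) :
    T.Filling (h ≫ f) where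
  fill c := (T.lim c).map h ≫ φ.fill c
  canon_fill c x := by
    simp [← canon_app, φ.canon_fill]
  leg_fill c z s := by
    simp [φ.leg_fill, proj_lim_map]

/-- Every map to a model has a filling. -/
noncomputable def ofIsModel {M : D ⥤ Type w} (hM : T.IsModel M) (f : X ⟶ M) : T.Filling f where
  fill c := (T.lim c).map f ≫
    TypeCat.ofHom (Equiv.ofBijective _ ((T.isModel_iff M).1 hM c)).symm
  canon_fill c x := by
    simp [← canon_app]
  leg_fill c z s := by
    have h := Equiv.ofBijective_apply_symm_apply _ ((T.isModel_iff M).1 hM c) ((T.lim c).map f s)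
    rw [← proj_lim_map, ← h, proj_canon]
    rfl

end Filling

/-- The first relation in terms of the universal property of the pushout that defines it. -/
theorem identifies₁_iff {X : D ⥤ Type w} {d : D} {x y : X.obj d} :
    T.Identifies₁ X d x y ↔ ∃ (c : T.K) (t : T.ou c ⟶ d), ∀ (Z : Type w)
      (g : (T.lim c).obj X → Z) (f : X.obj d → Z),
      (∀ a, g (T.canon c X a) = f (X.map t a)) → f x = f y := by
  refine exists_congr fun c => exists_congr fun t => ⟨fun h Z g f w => ?_, fun h => ?_⟩
  · have w' : T.canon c X ≫ TypeCat.ofHom g = X.map t ≫ TypeCat.ofHom f := by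
      ext a; exact w a
    have hf (x) : f x = pushout.desc _ _ w' (pushout.inr (T.canon c X) (X.map t) x) :=
      (ConcreteCategory.congr_hom (pushout.inr_desc _ _ w') x).symm
    rw [hf, hf, h]
  · exact h _ (pushout.inl (T.canon c X) (X.map t)) (pushout.inr (T.canon c X) (X.map t))
      fun a => ConcreteCategory.congr_hom
        (pushout.condition (f := T.canon c X) (g := X.map t)) a

theorem Identifies₁.of_canon_eq {X : D ⥤ Type w} {c : T.K} {a b : X.obj (T.ou c)}
    (h : T.canon c X a = T.canon c X b) : T.Identifies₁ X (T.ou c) a b :=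
  identifies₁_iff.2 ⟨c, 𝟙 _, fun Z g f w => by
    have hb := w b
    rw [← h, w a] at hb
    simpa using hb⟩

theorem Identifies₁.map {X : D ⥤ Type w} {d d' : D} (r : d ⟶ d') {x y : X.obj d}
    (h : T.Identifies₁ X d x y) : T.Identifies₁ X d' (X.map r x) (X.map r y) := by
  obtain ⟨c, t, h⟩ := identifies₁_iff.1 h
  exact identifies₁_iff.2 ⟨c, t ≫ r, fun Z g f w => h Z g (fun x => f (X.map r x)) (by simpa using w)⟩

theorem Identifies₁.app {X Y : D ⥤ Type w} (m : X ⟶ Y) {d : D} {x y : X.obj d}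
    (h : T.Identifies₁ X d x y) : T.Identifies₁ Y d (m.app d x) (m.app d y) := by
  obtain ⟨c, t, h⟩ := identifies₁_iff.1 h
  refine identifies₁_iff.2 ⟨c, t, fun Z g f w =>
    h Z (fun s => g ((T.lim c).map m s)) (fun x => f (m.app d x)) fun a => ?_⟩
  rw [← canon_app, w, NatTrans.naturality_apply]

/-- A map with a filling respects the first relation. -/
theorem Filling.app_eq {X Y : D ⥤ Type w} {f : X ⟶ Y} (φ : T.Filling f) {d : D} {x y : X.obj d}
    (h : T.Identifies₁ X d x y) : f.app d x = f.app d y := by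
  obtain ⟨c, t, h⟩ := identifies₁_iff.1 h
  refine h _ (fun s => Y.map t (φ.fill c s)) _ fun a => ?_
  rw [φ.canon_fill, NatTrans.naturality_apply]

/-! ### Colimits of chains with fillings -/

open Types.FilteredColimit in
/-- The colimit of a sequence in which every object maps to a later one by a map with a filling is a
model. Finiteness of the shapes is used to represent an element of `Q[c]`, and an equality
of two elements of `Q[c]`, at a single stage. -/
theorem isModel_of_isColimit [∀ c, FinCategory (T.Shape c)] {F : ℕ ⥤ (D ⥤ Type w)}
    (hF : ∀ i, ∃ j, ∃ h : i ≤ j, Nonempty (T.Filling (F.map (homOfLE h))))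
    {Q : Cocone F} (hQ : IsColimit Q) : T.IsModel Q.pt := by
  have hev (d : D) := isColimitOfPreserves ((evaluation D (Type w)).obj d) hQ
  have hw {i j : ℕ} (h : i ≤ j) {d : D} (x : (F.obj i).obj d) :
      (Q.ι.app j).app d ((F.map (homOfLE h)).app d x) = (Q.ι.app i).app d x := by
    rw [← Q.w (homOfLE h)]; rfl
  have hcomp {i j k : ℕ} (h : i ≤ j) (h' : j ≤ k) {d : D} (x : (F.obj i).obj d) :
      (F.map (homOfLE h')).app d ((F.map (homOfLE h)).app d x) =
        (F.map (homOfLE (h.trans h'))).app d x := by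
    rw [← homOfLE_comp h h', F.map_comp]; rfl
  have hsurj {d : D} (x : Q.pt.obj d) : ∃ i y, (Q.ι.app i).app d y = x :=
    Types.jointly_surjective_of_isColimit (hev d) x
  have heq {i : ℕ} {d : D} {x y : (F.obj i).obj d}
      (h : (Q.ι.app i).app d x = (Q.ι.app i).app d y) :
      ∃ j, ∃ h : i ≤ j, ∀ k (h' : j ≤ k), (F.map (homOfLE (h.trans h'))).app d x =
        (F.map (homOfLE (h.trans h'))).app d y := by
    obtain ⟨j, f, hj⟩ := (isColimit_eq_iff' (hev d) x y).1 h
    refine ⟨j, leOfHom f, fun k h' => ?_⟩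
    rw [← hcomp (leOfHom f) h', ← hcomp (leOfHom f) h']
    exact congrArg _ hj
  refine (T.isModel_iff _).2 fun c => ⟨fun a b hab => ?_, fun s => ?_⟩
  · obtain ⟨i, a', rfl⟩ := hsurj a
    obtain ⟨j, b', rfl⟩ := hsurj b
    obtain ⟨m, a, b, ha, hb⟩ : ∃ m, ∃ a b : (F.obj m).obj (T.ou c),
        (Q.ι.app m).app _ a = (Q.ι.app i).app _ a' ∧ (Q.ι.app m).app _ b = (Q.ι.app j).app _ b' :=
      ⟨max i j, _, _, hw (le_max_left i j) a', hw (le_max_right i j) b'⟩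
    rw [← ha, ← hb] at hab ⊢
    have h (z) : (Q.ι.app m).app _ ((F.obj m).map (T.leg c z) a) =
        (Q.ι.app m).app _ ((F.obj m).map (T.leg c z) b) := by
      rw [NatTrans.naturality_apply, NatTrans.naturality_apply]
      exact (proj_canon z _).symm.trans ((congrArg (T.proj c z Q.pt) hab).trans (proj_canon z _))
    -- Past all the finitely many `k z`, the canonical images of `a` and `b` agree.
    choose k hk hk' using fun z => heq (h z)
    obtain ⟨n, hn⟩ := (Set.finite_range k).bddAbove
    have hmn : m ≤ max m n := le_max_left _ _
    rw [← hw hmn a, ← hw hmn b]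
    have : T.canon c _ ((F.map (homOfLE hmn)).app _ a) =
        T.canon c _ ((F.map (homOfLE hmn)).app _ b) := by
      refine lim_ext fun z => ?_
      rw [proj_canon, proj_canon, ← NatTrans.naturality_apply, ← NatTrans.naturality_apply]
      exact hk' z _ ((hn ⟨z, rfl⟩).trans (le_max_right _ _))
    obtain ⟨l, hl, ⟨φ⟩⟩ := hF (max m n)
    rw [← hw hl, ← hw hl ((F.map (homOfLE hmn)).app _ b),
      ← φ.canon_fill, ← φ.canon_fill, this]
  · -- Lift the coordinates of `s` to a common stage `m`, then go on to a stage where they match.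
    choose i x hx using fun z => hsurj (T.proj c z _ s)
    obtain ⟨m, hm⟩ := (Set.finite_range i).bddAbove
    have him (z) : i z ≤ m := hm ⟨z, rfl⟩
    have hy (f : Σ z z', z ⟶ z') : (Q.ι.app m).app _ ((F.obj m).map ((T.diag c).map f.2.2)
        ((F.map (homOfLE (him f.1))).app _ (x f.1))) =
        (Q.ι.app m).app _ ((F.map (homOfLE (him f.2.1))).app _ (x f.2.1)) := by
      rw [NatTrans.naturality_apply, hw, hw, hx, hx]
      exact map_proj f.2.2 s
    choose k hk hk' using fun f => heq (hy f)
    obtain ⟨n, hn⟩ := (Set.finite_range k).bddAbove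
    have hmn : m ≤ max m n := le_max_left _ _
    obtain ⟨s', hs'⟩ := exists_proj_eq (T := T) (c := c) (X := F.obj (max m n))
      (fun z => (F.map (homOfLE ((him z).trans hmn))).app _ (x z)) (fun z z' f => by
        have := hk' ⟨z, z', f⟩ (max m n) ((hn ⟨_, rfl⟩).trans (le_max_right _ _))
        rw [hcomp, NatTrans.naturality_apply, hcomp] at this
        exact this)
    obtain ⟨l, hl, ⟨φ⟩⟩ := hF (max m n)
    refine ⟨(Q.ι.app _).app _ (φ.fill c s'), lim_ext fun z => ?_⟩
    rw [proj_canon, ← NatTrans.naturality_apply, φ.leg_fill, hs', hw, hw, hx]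

end LimitSketch

/-! ### Quotients and coproducts of functors to presheaves -/

section Quotients

variable {C D : Type*} [Category* C] [Category* D]

/-- A natural relation on the values of a functor `F : C ⥤ (D ⥤ Type w)`: a family of relations
preserved by all transition maps. It need not be an equivalence relation. -/
structure NatRel (F : C ⥤ (D ⥤ Type w)) where
  Rel : ∀ (X : C) (d : D), (F.obj X).obj d → (F.obj X).obj d → Prop
  map : ∀ {X : C} {d d' : D} (r : d ⟶ d') {x y}, Rel X d x y →
    Rel X d' ((F.obj X).map r x) ((F.obj X).map r y)
  app : ∀ {X Y : C} (m : X ⟶ Y) {d : D} {x y}, Rel X d x y →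
    Rel Y d ((F.map m).app d x) ((F.map m).app d y)

namespace CategoryTheory.NatTrans

theorem type_ext {X Y : D ⥤ Type w} {f g : X ⟶ Y} (h : ∀ d x, f.app d x = g.app d x) : f = g :=
  NatTrans.ext (funext fun d => ConcreteCategory.hom_ext _ _ (h d))

end CategoryTheory.NatTrans

namespace NatRel

variable {F : C ⥤ (D ⥤ Type w)} (R : NatRel F)

/-- The quotient of a functor by the natural equivalence relation generated by `R`. -/
def quot : C ⥤ (D ⥤ Type w) where
  obj X :=
    { obj := fun d => Quot (R.Rel X d)
      map := fun r => TypeCat.ofHom (Quot.map ((F.obj X).map r) fun _ _ => R.map r)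
      map_id := fun _ => by
        ext x; induction x using Quot.ind; simp [Quot.map]
      map_comp := fun r r' => by
        ext x; induction x using Quot.ind; simp [Quot.map] }
  map m :=
    { app := fun d => TypeCat.ofHom (Quot.map ((F.map m).app d) fun _ _ => R.app m)
      naturality := fun d d' r => by
        ext x; induction x using Quot.ind
        simp [Quot.map, NatTrans.naturality_apply] }
  map_id X := by
    ext d x; induction x using Quot.ind; simp [Quot.map]
  map_comp m m' := by
    ext d x; induction x using Quot.ind; simp [Quot.map]

/-- The quotient map. -/
def proj : F ⟶ R.quot where
  app _ :=
    { app := fun _ => TypeCat.ofHom (Quot.mk _)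
      naturality := fun _ _ _ => rfl }
  naturality _ _ _ := rfl

theorem proj_surjective (X : C) (d : D) : Function.Surjective ((R.proj.app X).app d) :=
  Quot.mk_surjective

instance (X : C) : Epi (R.proj.app X) := by
  have (d : D) : Epi ((R.proj.app X).app d) := (epi_iff_surjective _).2 (R.proj_surjective X d)
  exact NatTrans.epi_of_epi_app _

theorem proj_eq_iff {X : C} {d : D} {x y : (F.obj X).obj d} :
    (R.proj.app X).app d x = (R.proj.app X).app d y ↔ Relation.EqvGen (R.Rel X d) x y :=
  Quot.eq

variable {R} in
theorem sound {X : C} {d : D} {x y : (F.obj X).obj d} (h : R.Rel X d x y) :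
    (R.proj.app X).app d x = (R.proj.app X).app d y :=
  Quot.sound h

/-- The map out of the quotient of `F.obj X` induced by a map that respects the relation. -/
def desc {X : C} {M : D ⥤ Type w} (f : F.obj X ⟶ M)
    (h : ∀ d x y, R.Rel X d x y → f.app d x = f.app d y) : R.quot.obj X ⟶ M where
  app d := TypeCat.ofHom (Quot.lift (f.app d) (h d))
  naturality d d' r := by
    ext x; induction x using Quot.ind
    exact NatTrans.naturality_apply f r _

end NatRel

/-- The objectwise coproduct of two functors to presheaves. -/
def sumFunctor (F G : C ⥤ (D ⥤ Type w)) : C ⥤ (D ⥤ Type w) where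
  obj X := FunctorToTypes.coprod (F.obj X) (G.obj X)
  map m := FunctorToTypes.coprod.desc (F.map m ≫ FunctorToTypes.coprod.inl)
    (G.map m ≫ FunctorToTypes.coprod.inr)
  map_id X := NatTrans.type_ext <| by
    rintro d (x | x)
    · exact congrArg Sum.inl (congr($(F.map_id X).app d x))
    · exact congrArg Sum.inr (congr($(G.map_id X).app d x))
  map_comp m m' := NatTrans.type_ext <| by
    rintro d (x | x)
    · exact congrArg Sum.inl (congr($(F.map_comp m m').app d x))
    · exact congrArg Sum.inr (congr($(G.map_comp m m').app d x))

/-- The left summand. -/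
def sumInl (F G : C ⥤ (D ⥤ Type w)) : F ⟶ sumFunctor F G where
  app _ := FunctorToTypes.coprod.inl

/-- The right summand. -/
def sumInr (F G : C ⥤ (D ⥤ Type w)) : G ⟶ sumFunctor F G where
  app _ := FunctorToTypes.coprod.inr

end Quotients

namespace LimitSketch

variable {D : Type w} [SmallCategory.{w} D] (T : LimitSketch.{w} D)

/-! ### The free presheaf on the values at the cones -/

/-- The left Kan extension of `c ↦ X[c]` along `ou`, in the explicit form
`d ↦ Σ c, D(ou(c), d) × X[c]`, as a functor of `X`. -/
noncomputable def coneFree : (D ⥤ Type w) ⥤ (D ⥤ Type w) where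
  obj X :=
    { obj := fun d => Σ c : T.K, (T.ou c ⟶ d) × (T.lim c).obj X
      map := fun r => TypeCat.ofHom fun e => ⟨e.1, e.2.1 ≫ r, e.2.2⟩ }
  map m :=
    { app := fun d => TypeCat.ofHom fun e => ⟨e.1, e.2.1, (T.lim e.1).map m e.2.2⟩ }

/-- The universal element `s ↦ (c, 𝟙, s)`. -/
noncomputable def coneFreeUnit (c : T.K) (X : D ⥤ Type w) :
    (T.lim c).obj X ⟶ (T.coneFree.obj X).obj (T.ou c) :=
  TypeCat.ofHom fun s => ⟨c, 𝟙 _, s⟩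

variable {T}

/-- Every element of `coneFree` is the translate of a universal one. -/
theorem coneFree_eq {X : D ⥤ Type w} {d : D} (e : (T.coneFree.obj X).obj d) :
    e = (T.coneFree.obj X).map e.2.1 (T.coneFreeUnit e.1 X e.2.2) := by
  obtain ⟨c, t, s⟩ := e
  exact congrArg (fun u => (⟨c, u, s⟩ : (T.coneFree.obj X).obj d)) (Category.id_comp t).symm

/-- The map out of `coneFree` given by its values on universal elements. -/
noncomputable def coneFreeDesc {X Y : D ⥤ Type w} (g : ∀ c, (T.lim c).obj X ⟶ Y.obj (T.ou c)) :
    T.coneFree.obj X ⟶ Y where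
  app _ := TypeCat.ofHom fun e => Y.map e.2.1 (g e.1 e.2.2)
  naturality _ _ r := ConcreteCategory.hom_ext _ _ fun e =>
    Functor.map_comp_apply Y e.2.1 r (g e.1 e.2.2)

@[simp]
theorem coneFreeDesc_unit {X Y : D ⥤ Type w} (g : ∀ c, (T.lim c).obj X ⟶ Y.obj (T.ou c))
    (c : T.K) (s : (T.lim c).obj X) :
    (coneFreeDesc g).app (T.ou c) (T.coneFreeUnit c X s) = g c s :=
  ConcreteCategory.congr_hom (Y.map_id _) (g c s)

theorem coneFree_hom_ext {X Y : D ⥤ Type w} {f g : T.coneFree.obj X ⟶ Y}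
    (h : ∀ c s, f.app (T.ou c) (T.coneFreeUnit c X s) =
      g.app (T.ou c) (T.coneFreeUnit c X s)) : f = g := by
  refine NatTrans.type_ext fun d e => ?_
  rw [coneFree_eq e, NatTrans.naturality_apply, NatTrans.naturality_apply, h]

theorem isLeftKanExtension_coneFree (X : D ⥤ Type w) :
    (T.coneFree.obj X).IsLeftKanExtension (L := T.ouFunctor) (F := T.limFunctor X)
      (Discrete.natTrans fun c => T.coneFreeUnit c.as X) where
  nonempty_isUniversal := ⟨by
    refine IsInitial.ofUniqueHom (fun G => StructuredArrow.homMk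
      (coneFreeDesc fun c => G.hom.app ⟨c⟩) ?_) fun G m => ?_
    · refine NatTrans.type_ext fun ⟨c⟩ s => ?_
      exact coneFreeDesc_unit (fun c => G.hom.app ⟨c⟩) c s
    · apply StructuredArrow.ext
      refine coneFree_hom_ext fun c s => ?_
      refine Eq.trans ?_ (coneFreeDesc_unit (fun c => G.hom.app ⟨c⟩) c s).symm
      exact ConcreteCategory.congr_hom (NatTrans.congr_app (StructuredArrow.w m) ⟨c⟩) s⟩


variable (T)

/-! ### The stages of the construction -/

variable (D) in
/-- A stage of the construction: the summands `B` and `E` of an object `S = B + E`, functorially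
in the presentation, and the relation on `S` inherited from the previous stage. -/
structure Stage where
  B : (D ⥤ Type w) ⥤ (D ⥤ Type w)
  E : (D ⥤ Type w) ⥤ (D ⥤ Type w)
  rel : NatRel (sumFunctor B E)

namespace Stage

variable (A : Stage D)

/-- The object `S = B + E`. -/
abbrev S : (D ⥤ Type w) ⥤ (D ⥤ Type w) := sumFunctor A.B A.E

/-- The union of the first relation with the inherited one. -/
def total : NatRel A.S where
  Rel X d x y := T.Identifies₁ (A.S.obj X) d x y ∨ A.rel.Rel X d x y
  map r _ _ h := h.imp (fun h => h.map r) (A.rel.map r)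
  app m _ _ _ h := h.imp (fun h => h.app (A.S.map m)) (A.rel.app m)

/-- The functor `S` of the next stage: the quotient of `S` plus the free presheaf on the
values `S[c]`. -/
noncomputable abbrev nextS : (D ⥤ Type w) ⥤ (D ⥤ Type w) :=
  sumFunctor (A.total T).quot (A.S ⋙ T.coneFree)

/-- The map from a stage to the next one. -/
noncomputable def step : A.S ⟶ A.nextS T := (A.total T).proj ≫ sumInl _ _

/-- The new element of the next stage attached to an element of `S[c]`. -/
noncomputable def new (c : T.K) (X : D ⥤ Type w) :
    (T.lim c).obj (A.S.obj X) ⟶ ((A.nextS T).obj X).obj (T.ou c) :=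
  T.coneFreeUnit c (A.S.obj X) ≫
    ((sumInr (A.total T).quot (A.S ⋙ T.coneFree)).app X).app (T.ou c)

theorem new_naturality (c : T.K) {X Y : D ⥤ Type w} (m : X ⟶ Y) (s : (T.lim c).obj (A.S.obj X)) :
    ((A.nextS T).map m).app _ (A.new T c X s) = A.new T c Y ((T.lim c).map (A.S.map m) s) :=
  rfl

/-- The relation that identifies, in the next stage, the restriction along `ρ_z` of the new element
attached to `s` with the class of its coordinate `proj_z s`. -/
inductive BaseRel (X : D ⥤ Type w) (d : D) :
    ((A.nextS T).obj X).obj d → ((A.nextS T).obj X).obj d → Prop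
  | mk (c : T.K) (z : T.Shape c) (t : (T.diag c).obj z ⟶ d) (s : (T.lim c).obj (A.S.obj X)) :
    BaseRel X d
      (((A.nextS T).obj X).map t (((A.nextS T).obj X).map (T.leg c z) (A.new T c X s)))
      (((A.nextS T).obj X).map t (((A.step T).app X).app _ (T.proj c z (A.S.obj X) s)))

/-- The next stage: `B` becomes the quotient of `S`, and `E` the free presheaf on the
values `S[c]`. -/
noncomputable abbrev next : Stage D where
  B := (A.total T).quot
  E := A.S ⋙ T.coneFree
  rel :=
    { Rel := A.BaseRel T
      map := by
        rintro X d d' r _ _ ⟨c, z, t, s⟩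
        have := BaseRel.mk (A := A) (X := X) c z (t ≫ r) s
        rwa [Functor.map_comp_apply, Functor.map_comp_apply] at this
      app := by
        rintro X Y m d _ _ ⟨c, z, t, s⟩
        have := BaseRel.mk (A := A) (X := Y) c z t ((T.lim c).map (A.S.map m) s)
        rw [proj_lim_map, ← new_naturality, ← NatTrans.naturality_apply,
          ← NatTrans.naturality_apply] at this
        rw [NatTrans.naturality_apply ((A.nextS T).map m) t]
        have h : ((A.step T).app Y).app _ ((A.S.map m).app _ (T.proj c z _ s)) =
            ((A.nextS T).map m).app _ (((A.step T).app X).app _ (T.proj c z _ s)) :=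
          congr($((A.step T).naturality m).app _ _)
        rw [h, ← NatTrans.naturality_apply] at this
        exact this }

variable {T A} {X Y : D ⥤ Type w}

theorem step_eq_of_identifies₁ {d : D} {x y : (A.S.obj X).obj d}
    (h : T.Identifies₁ (A.S.obj X) d x y) :
    ((A.step T).app X).app d x = ((A.step T).app X).app d y :=
  congrArg (((sumInl _ _).app X).app d) (NatRel.sound (R := A.total T) (Or.inl h))

theorem step_eq_of_rel {d : D} {x y : (A.S.obj X).obj d} (h : A.rel.Rel X d x y) :
    ((A.step T).app X).app d x = ((A.step T).app X).app d y :=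
  congrArg (((sumInl _ _).app X).app d) (NatRel.sound (R := A.total T) (Or.inr h))

/-- One stage after its introduction, a new element has the prescribed coordinates. -/
theorem map_leg_step_new (c : T.K) (z : T.Shape c) (s : (T.lim c).obj (A.S.obj X)) :
    (((A.next T).nextS T).obj X).map (T.leg c z)
        ((((A.next T).step T).app X).app _ (A.new T c X s)) =
      (((A.next T).step T).app X).app _ (((A.step T).app X).app _ (T.proj c z _ s)) := by
  have := BaseRel.mk (T := T) (A := A) (X := X) c z (𝟙 _) s
  rw [Functor.map_id_apply, Functor.map_id_apply] at this
  rw [← NatTrans.naturality_apply]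
  exact step_eq_of_rel (A := A.next T) this

/-- Three steps have a filling: a new element acquires its coordinates after one step, and
then the first relation makes it equal to any older element with the same coordinates. -/
noncomputable def filling (A : Stage D) (X : D ⥤ Type w) :
    T.Filling ((A.step T).app X ≫ ((A.next T).step T).app X ≫
      (((A.next T).next T).step T).app X) where
  fill c := A.new T c X ≫ (((A.next T).step T).app X).app _ ≫
    ((((A.next T).next T).step T).app X).app _
  canon_fill c x := by
    refine step_eq_of_identifies₁ (A := (A.next T).next T) (Identifies₁.of_canon_eq ?_)
    refine lim_ext fun z => ?_
    rw [proj_canon, proj_canon]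
    refine (map_leg_step_new c z _).trans ?_
    rw [proj_canon, NatTrans.naturality_apply, NatTrans.naturality_apply]
    rfl
  leg_fill c z s := by
    refine (NatTrans.naturality_apply ((((A.next T).next T).step T).app X) _ _).symm.trans ?_
    exact congrArg (((((A.next T).next T).step T).app X).app _) (map_leg_step_new c z s)

/-- A map out of the next stage is determined by its values on the current stage and on the new
elements. -/
theorem next_hom_ext {g g' : ((A.next T).S).obj X ⟶ Y}
    (h : (A.step T).app X ≫ g = (A.step T).app X ≫ g')
    (h' : ∀ c s, g.app _ (A.new T c X s) = g'.app _ (A.new T c X s)) : g = g' := by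
  have h₁ : (sumInl _ _).app X ≫ g = (sumInl _ _).app X ≫ g' := by
    rw [← cancel_epi ((A.total T).proj.app X)]
    exact h
  have h₂ : (sumInr _ _).app X ≫ g = (sumInr _ _).app X ≫ g' := coneFree_hom_ext h'
  refine NatTrans.type_ext ?_
  rintro d (x | x)
  · exact congr($(h₁).app d x)
  · exact congr($(h₂).app d x)

/-- A map from a stage to a model that extends two stages further is determined by its
restriction to the previous stage. -/
theorem hom_ext_of_isModel {M : D ⥤ Type w} (hM : T.IsModel M)
    {g g' : ((A.next T).next T).S.obj X ⟶ M}
    (h : (A.step T).app X ≫ ((A.next T).step T).app X ≫ g =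
      (A.step T).app X ≫ ((A.next T).step T).app X ≫ g') :
    ((A.next T).step T).app X ≫ g = ((A.next T).step T).app X ≫ g' := by
  refine next_hom_ext h fun c s => ((T.isModel_iff M).1 hM c).1 (lim_ext fun z => ?_)
  have key (g : ((A.next T).next T).S.obj X ⟶ M) :
      T.proj c z M (T.canon c M ((((A.next T).step T).app X ≫ g).app _ (A.new T c X s))) =
        ((A.step T).app X ≫ ((A.next T).step T).app X ≫ g).app _ (T.proj c z _ s) := by
    rw [proj_canon]
    refine (NatTrans.naturality_apply g _ _).symm.trans ?_
    exact congrArg (g.app _) (map_leg_step_new c z s)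
  rw [key, key, h]

/-- The extension of a map to the next stage, given a filling. -/
noncomputable def desc (f : A.S.obj X ⟶ Y)
    (hf : ∀ d x y, A.rel.Rel X d x y → f.app d x = f.app d y) (φ : T.Filling f) :
    (A.next T).S.obj X ⟶ Y :=
  FunctorToTypes.coprod.desc
    ((A.total T).desc f fun d x y h => h.elim φ.app_eq (hf d x y)) (coneFreeDesc φ.fill)

section

variable (f : A.S.obj X ⟶ Y) (hf : ∀ d x y, A.rel.Rel X d x y → f.app d x = f.app d y)
  (φ : T.Filling f)

theorem desc_new (c : T.K) (s : (T.lim c).obj (A.S.obj X)) :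
    (desc f hf φ).app _ (A.new T c X s) = φ.fill c s :=
  coneFreeDesc_unit _ c s

theorem desc_eq_of_rel (d : D) (x y) (h : (A.next T).rel.Rel X d x y) :
    (desc f hf φ).app d x = (desc f hf φ).app d y := by
  obtain ⟨c, z, t, s⟩ := h
  refine (NatTrans.naturality_apply (desc f hf φ) t _).trans <|
    (congrArg (Y.map t) ?_).trans (NatTrans.naturality_apply (desc f hf φ) t _).symm
  refine (NatTrans.naturality_apply (desc f hf φ) _ _).trans ?_
  rw [desc_new, φ.leg_fill]
  rfl

end

end Stage

/-! ### The sequence of stages and its colimit -/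

/-- The sequence of stages, starting from `B = 𝟭` and `E = ∅`. -/
noncomputable def stage : ℕ → Stage D
  | 0 =>
    { B := 𝟭 _
      E := (Functor.const _).obj ((Functor.const _).obj PEmpty)
      rel := { Rel := fun _ _ _ _ => False, map := fun _ _ _ h => h, app := fun _ _ _ _ h => h } }
  | n + 1 => (stage n).next T

/-- The maps of the sequence of stages. -/
noncomputable def stageStep (n : ℕ) : (T.stage n).S ⟶ (T.stage (n + 1)).S :=
  (T.stage n).step T

/-- The elimination of quotients formed by the stages. -/
noncomputable def elimination : T.EliminationData where
  B i := (T.stage i).B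
  E i := (T.stage i).E
  S i := (T.stage i).S
  inl _ := sumInl _ _
  inr _ := sumInr _ _
  p i := ((T.stage i).total T).proj
  a i c := { app := fun X => T.coneFreeUnit c ((T.stage i).S.obj X) }
  zeroIso := Iso.refl _

/-- The inherited relation of a stage is the second relation. -/
theorem elimination_identifies (i : ℕ) (X : D ⥤ Type w) (d : D)
    (x y : ((T.elimination.S i).obj X).obj d) :
    T.elimination.Identifies i X d x y ↔ ((T.stage i).total T).Rel X d x y := by
  refine or_congr Iff.rfl ?_
  cases i with
  | zero => exact Iff.rfl
  | succ i =>
    constructor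
    · rintro ⟨c, z, t, s, rfl, rfl⟩
      exact .mk c z t s
    · rintro ⟨c, z, t, s⟩
      exact ⟨c, z, t, s, rfl, rfl⟩

/-- The map `X ⟶ S_0(X)`. -/
noncomputable abbrev toStageZero (X : D ⥤ Type w) : X ⟶ (T.stage 0).S.obj X :=
  (sumInl (T.stage 0).B (T.stage 0).E).app X

variable {T}

theorem stage_zero_hom_ext {X Y : D ⥤ Type w} {g g' : (T.stage 0).S.obj X ⟶ Y}
    (h : T.toStageZero X ≫ g = T.toStageZero X ≫ g') : g = g' := by
  refine NatTrans.type_ext ?_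
  rintro d (x | x)
  · exact congr($(h).app d x)
  · exact x.elim

/-- The map from `S_0(X)` induced by a map from `X`. -/
noncomputable def stageZeroDesc {X Y : D ⥤ Type w} (f : X ⟶ Y) : (T.stage 0).S.obj X ⟶ Y :=
  FunctorToTypes.coprod.desc f
    { app := fun _ => TypeCat.ofHom PEmpty.elim, naturality := fun _ _ _ => by ext x; exact x.elim }

/-- The extension of a map from `X` to a model along the sequence of stages. -/
noncomputable def stageDesc {X M : D ⥤ Type w} (hM : T.IsModel M) (f : X ⟶ M) : ∀ n : ℕ,
    { g : (T.stage n).S.obj X ⟶ M //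
      ∀ d x y, (T.stage n).rel.Rel X d x y → g.app d x = g.app d y }
  | 0 => ⟨stageZeroDesc f, fun _ _ _ h => h.elim⟩
  | n + 1 =>
    let g := stageDesc hM f n
    let φ := Filling.ofIsModel hM g.1
    ⟨Stage.desc g.1 g.2 φ, Stage.desc_eq_of_rel g.1 g.2 φ⟩

/-- `Stage.filling` for the members of the sequence. -/
noncomputable def stageFilling (X : D ⥤ Type w) (n : ℕ) :
    T.Filling ((T.stageStep n).app X ≫ (T.stageStep (n + 1)).app X ≫ (T.stageStep (n + 2)).app X) :=
  (T.stage n).filling X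

/-- A compatible family of maps from the stages to a model is determined by its value on `X`. -/
theorem stage_hom_ext {X M : D ⥤ Type w} (hM : T.IsModel M)
    {q q' : ∀ n : ℕ, (T.stage n).S.obj X ⟶ M}
    (hq : ∀ n, (T.stageStep n).app X ≫ q (n + 1) = q n)
    (hq' : ∀ n, (T.stageStep n).app X ≫ q' (n + 1) = q' n)
    (h : T.toStageZero X ≫ q 0 = T.toStageZero X ≫ q' 0) (n : ℕ) : q n = q' n := by
  induction n with
  | zero => exact stage_zero_hom_ext h
  | succ n ih =>
    rw [← hq, ← hq', ← hq, ← hq'] at ih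
    rw [← hq, ← hq']
    exact Stage.hom_ext_of_isModel hM ih

/-- The colimit of the stages is the reflector. -/
theorem isReflector_of_isColimit [∀ c, FinCategory (T.Shape c)] (X : D ⥤ Type w)
    {Q : Cocone (Functor.ofSequence fun n => (T.stageStep n).app X)} (hQ : IsColimit Q) :
    T.IsReflector (T.toStageZero X ≫ Q.ι.app 0) := by
  refine ⟨isModel_of_isColimit (fun n => ⟨n + 1 + 1 + 1, by omega, ⟨?_⟩⟩) hQ, fun M hM f => ?_⟩
  · have h : homOfLE (show n ≤ n + 1 + 1 + 1 by omega) = homOfLE (Nat.le_add_right n 1) ≫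
      homOfLE (Nat.le_add_right (n + 1) 1) ≫ homOfLE (Nat.le_add_right (n + 2) 1) := rfl
    rw [h, Functor.map_comp, Functor.map_comp, Functor.ofSequence_map_homOfLE_succ,
      Functor.ofSequence_map_homOfLE_succ, Functor.ofSequence_map_homOfLE_succ]
    exact stageFilling X n
  · have hw (g : Q.pt ⟶ M) (n : ℕ) :
        (T.stageStep n).app X ≫ Q.ι.app (n + 1) ≫ g = Q.ι.app n ≫ g := by
      rw [← Q.w (homOfLE (Nat.le_add_right n 1)), Functor.ofSequence_map_homOfLE_succ]
      rfl
    let s : Cocone (Functor.ofSequence fun n => (T.stageStep n).app X) :=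
      { pt := M
        ι := NatTrans.ofSequence (fun n => (stageDesc hM f n).1) fun n => by
          rw [Functor.ofSequence_map_homOfLE_succ]
          rfl }
    have hs : (T.toStageZero X ≫ Q.ι.app 0) ≫ hQ.desc s = f :=
      congrArg (T.toStageZero X ≫ ·) (hQ.fac s 0)
    exact ⟨hQ.desc s, hs, fun g hg => hQ.hom_ext
      (stage_hom_ext hM (hw g) (hw (hQ.desc s)) (hg.trans hs.symm))⟩

/-! ### Comparison with Kelly's sequence -/

/-- The class of `(t, s)` in `P_c(X)`. -/
def kellyNew {c : T.K} {X : D ⥤ Type w} {d : D} (t : T.ou c ⟶ d) (s : (T.lim c).obj X) :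
    ((T.kellyCone c).obj X).obj d :=
  Quot.mk _ (Sum.inr (t, s))

section

variable {c : T.K} {X Y : D ⥤ Type w} {d : D}

theorem kellyNew_canon (t : T.ou c ⟶ d) (x : X.obj (T.ou c)) :
    kellyNew t (T.canon c X x) = ((T.kellyConeUnit c).app X).app d (X.map t x) :=
  Quot.sound (.vertex t x)

theorem kellyNew_leg (z : T.Shape c) (t : (T.diag c).obj z ⟶ d) (s : (T.lim c).obj X) :
    kellyNew (T.leg c z ≫ t) s = ((T.kellyConeUnit c).app X).app d (X.map t (T.proj c z X s)) :=
  Quot.sound (.base z t s)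

theorem map_kellyNew {d' : D} (t : T.ou c ⟶ d) (r : d ⟶ d') (s : (T.lim c).obj X) :
    ((T.kellyCone c).obj X).map r (kellyNew t s) = kellyNew (t ≫ r) s :=
  rfl

/-- An element of `P_c(X)` comes from `X` or is a translate of the class of some `(𝟙, s)`. -/
theorem kellyCone_cases (e : ((T.kellyCone c).obj X).obj d) :
    (∃ x, e = ((T.kellyConeUnit c).app X).app d x) ∨
      ∃ t s, e = ((T.kellyCone c).obj X).map t (kellyNew (𝟙 _) s) := by
  induction e using Quot.ind with
  | mk e =>
    rcases e with x | ⟨t, s⟩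
    · exact .inl ⟨x, rfl⟩
    · refine .inr ⟨t, s, ?_⟩
      rw [map_kellyNew, Category.id_comp]
      rfl

variable (T) in
theorem kellyConeUnit_incl (c : T.K) : T.kellyConeUnit c ≫ T.kellyIncl c = T.kellyUnit :=
  WidePushout.arrow_ι T.kellyConeUnit c

theorem kellyIncl_unit (x : X.obj d) :
    ((T.kellyIncl c).app X).app d (((T.kellyConeUnit c).app X).app d x) =
      (T.kellyUnit.app X).app d x :=
  congr(($(T.kellyConeUnit_incl c).app X).app d x)

end

/-- Kelly's arrow `i : X ⟶ P(X)` has a filling, by the classes of `(𝟙, s)`. -/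
noncomputable def kellyFilling (X : D ⥤ Type w) :
    T.Filling (X := X) (Y := T.kelly.obj X) (T.kellyUnit.app X) where
  fill c := TypeCat.ofHom (kellyNew (𝟙 _)) ≫ ((T.kellyIncl c).app X).app (T.ou c)
  canon_fill c x := by
    refine (congrArg (((T.kellyIncl c).app X).app (T.ou c)) (kellyNew_canon _ x)).trans ?_
    rw [Functor.map_id_apply]
    exact kellyIncl_unit x
  leg_fill c z s := by
    have h : kellyNew (𝟙 _ ≫ T.leg c z) s = _ :=
      (congrArg (fun t => kellyNew t s) (by simp)).trans (kellyNew_leg z (𝟙 _) s)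
    rw [Functor.map_id_apply] at h
    exact (NatTrans.naturality_apply ((T.kellyIncl c).app X) _ _).symm.trans
      ((congrArg (((T.kellyIncl c).app X).app _) h).trans (kellyIncl_unit _))

theorem kellyFilling_naturality {c : T.K} {X Y : D ⥤ Type w} (m : X ⟶ Y) (s : (T.lim c).obj X) :
    (T.kelly.map m).app _ ((kellyFilling X).fill c s) =
      (kellyFilling Y).fill c ((T.lim c).map m s) :=
  congr(($((T.kellyIncl c).naturality m)).app _ (kellyNew (𝟙 _) s)).symm

/-- The values of a filling have the prescribed canonical images. -/
theorem Filling.canon_fill_eq {X Y : D ⥤ Type w} {f : X ⟶ Y} (φ : T.Filling f) (c : T.K)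
    (s : (T.lim c).obj X) : T.canon c Y (φ.fill c s) = (T.lim c).map f s :=
  lim_ext fun z => by rw [proj_canon, φ.leg_fill, proj_lim_map]

theorem kellyCone_hom_ext {c : T.K} {X Y : D ⥤ Type w} {f g : (T.kellyCone c).obj X ⟶ Y}
    (h : (T.kellyConeUnit c).app X ≫ f = (T.kellyConeUnit c).app X ≫ g)
    (h' : ∀ s, f.app _ (kellyNew (𝟙 _) s) = g.app _ (kellyNew (𝟙 _) s)) : f = g := by
  refine NatTrans.type_ext fun d e => ?_
  obtain ⟨x, rfl⟩ | ⟨t, s, rfl⟩ := kellyCone_cases e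
  · exact congr(($h).app d x)
  · rw [NatTrans.naturality_apply, NatTrans.naturality_apply, h']

/-- The pointed endofunctor `(P, i)` is well-pointed: `P(i) = i P`. If `e` is the element of
`P(X)(ou(c))` attached to `s`, then `P(i)` sends it to the element attached to `i[c](s) = canon(e)`,
which is `i(e)` by the vertex relation. -/
theorem kelly_wellPointed (X : D ⥤ Type w) :
    T.kelly.map (T.kellyUnit.app X) = T.kellyUnit.app (T.kelly.obj X) := by
  let f₁ : T.kelly ⟶ T.kelly ⋙ T.kelly := Functor.whiskerRight T.kellyUnit T.kelly
  let f₂ : T.kelly ⟶ T.kelly ⋙ T.kelly := Functor.whiskerLeft T.kelly T.kellyUnit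
  have hu : T.kellyUnit ≫ f₁ = T.kellyUnit ≫ f₂ := by
    ext1; ext1 X
    exact (T.kellyUnit.naturality (T.kellyUnit.app X)).symm
  suffices f₁ = f₂ from congr(($this).app X)
  refine WidePushout.hom_ext T.kellyConeUnit f₁ f₂ (fun c => ?_) hu
  refine NatTrans.ext (funext fun X => kellyCone_hom_ext ?_ fun s => ?_)
  · have h := congr(($hu).app X)
    rw [← T.kellyConeUnit_incl c] at h
    exact h
  · refine (kellyFilling_naturality (T.kellyUnit.app X) s).trans ?_
    rw [← (kellyFilling X).canon_fill_eq, (kellyFilling (T.kelly.obj X)).canon_fill]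
    rfl

/-- The arrows of Kelly's sequence are instances of the unit `i`. -/
theorem kellyStep_app (n : ℕ) (X : D ⥤ Type w) :
    (T.kellyStep n).app X = T.kellyUnit.app ((T.kellyPow n).obj X) := by
  induction n with
  | zero => rfl
  | succ n ih => exact (congrArg T.kelly.map ih).trans (kelly_wellPointed _)

namespace Stage

variable {A : Stage D} {F : (D ⥤ Type w) ⥤ (D ⥤ Type w)} (α : A.S ⟶ F)
  (hα : ∀ X d x y, A.rel.Rel X d x y → (α.app X).app d x = (α.app X).app d y)

/-- The component at `X` of `Stage.toKelly`. -/
noncomputable def toKellyApp (X : D ⥤ Type w) : (A.next T).S.obj X ⟶ T.kelly.obj (F.obj X) :=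
  desc (α.app X ≫ T.kellyUnit.app (F.obj X))
    (fun d x y h => congrArg ((T.kellyUnit.app (F.obj X)).app d) (hα X d x y h))
    ((kellyFilling (F.obj X)).precomp (α.app X))

theorem step_toKellyApp (X : D ⥤ Type w) :
    (A.step T).app X ≫ toKellyApp α hα X = α.app X ≫ T.kellyUnit.app (F.obj X) :=
  rfl

theorem toKellyApp_new (X : D ⥤ Type w) (c : T.K) (s : (T.lim c).obj (A.S.obj X)) :
    (toKellyApp α hα X).app _ (A.new T c X s) =
      (kellyFilling (F.obj X)).fill c ((T.lim c).map (α.app X) s) :=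
  desc_new _ _ _ c s

theorem toKellyApp_eq_of_rel (X : D ⥤ Type w) (d : D) (x y)
    (h : (A.next T).rel.Rel X d x y) :
    (toKellyApp (T := T) α hα X).app d x = (toKellyApp α hα X).app d y :=
  desc_eq_of_rel _ _ _ d x y h

/-- The extension of a comparison map from a stage to a functor `F` to one from the next
stage to `P ∘ F`. -/
noncomputable def toKelly : (A.next T).S ⟶ F ⋙ T.kelly where
  app X := toKellyApp α hα X
  naturality X Y m := by
    refine next_hom_ext ?_ fun c s => ?_
    · calc (A.step T).app X ≫ (A.nextS T).map m ≫ toKellyApp α hα Y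
          = A.S.map m ≫ (A.step T).app Y ≫ toKellyApp α hα Y := by
            rw [← NatTrans.naturality_assoc]
        _ = α.app X ≫ F.map m ≫ T.kellyUnit.app (F.obj Y) := by
            rw [step_toKellyApp, NatTrans.naturality_assoc]
        _ = (α.app X ≫ T.kellyUnit.app (F.obj X)) ≫ T.kelly.map (F.map m) :=
            congrArg (α.app X ≫ ·) (T.kellyUnit.naturality (F.map m))
    · refine (toKellyApp_new α hα Y c ((T.lim c).map (A.S.map m) s)).trans ?_
      refine Eq.trans ?_
        (congrArg ((T.kelly.map (F.map m)).app _) (toKellyApp_new α hα X c s)).symm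
      rw [kellyFilling_naturality, ← Functor.map_comp_apply, ← Functor.map_comp_apply,
        NatTrans.naturality]

end Stage

variable (T) in
/-- The comparison of the sequence of stages with Kelly's sequence. -/
noncomputable def stageToKelly : ∀ n : ℕ, { α : (T.stage n).S ⟶ T.kellyPow n //
    ∀ X d x y, (T.stage n).rel.Rel X d x y → (α.app X).app d x = (α.app X).app d y }
  | 0 => ⟨{ app := fun X => stageZeroDesc (𝟙 X)
            naturality := fun _ _ _ => stage_zero_hom_ext rfl }, fun _ _ _ _ h => h.elim⟩
  | n + 1 => ⟨Stage.toKelly (stageToKelly n).1 (stageToKelly n).2,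
      Stage.toKellyApp_eq_of_rel (stageToKelly n).1 (stageToKelly n).2⟩

theorem stageStep_toKelly (n : ℕ) :
    T.stageStep n ≫ (T.stageToKelly (n + 1)).1 = (T.stageToKelly n).1 ≫ T.kellyStep n := by
  refine NatTrans.ext (funext fun X => ?_)
  exact (Stage.step_toKellyApp (T.stageToKelly n).1 (T.stageToKelly n).2 X).trans
    (congrArg ((T.stageToKelly n).1.app X ≫ ·) (kellyStep_app n X).symm)

/-- A map from `P_c(Y)` to a coproduct factors through the left summand once its restriction to `Y`
does: a new element restricts along the legs of `c` to elements coming from `Y`, so it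
cannot lie in the right summand. If `c` has no legs, a new element itself comes from `Y`, as soon
as `Y(ou(c))` is inhabited. -/
theorem exists_factor_inl {F G : (D ⥤ Type w) ⥤ (D ⥤ Type w)} {X Y : D ⥤ Type w} {c : T.K}
    (hY : IsEmpty (T.Shape c) → Nonempty (Y.obj (T.ou c)))
    (v : (T.kellyCone c).obj Y ⟶ (sumFunctor F G).obj X) (w : Y ⟶ F.obj X)
    (hv : (T.kellyConeUnit c).app Y ≫ v = w ≫ (sumInl F G).app X) :
    ∃ v', v' ≫ (sumInl F G).app X = v := by
  have hunit (d : D) (x : Y.obj d) : v.app d (((T.kellyConeUnit c).app Y).app d x) =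
      ((sumInl F G).app X).app d (w.app d x) := congr(($hv).app d x)
  have hinj (d : D) : Function.Injective (((sumInl F G).app X).app d) := Sum.inl_injective
  have hnew (s : (T.lim c).obj Y) :
      ∃ b, ((sumInl F G).app X).app _ b = v.app _ (kellyNew (𝟙 (T.ou c)) s) := by
    cases isEmpty_or_nonempty (T.Shape c) with
    | inl h =>
      obtain ⟨x⟩ := hY h
      obtain rfl : T.canon c Y x = s := lim_ext fun z => h.elim z
      exact ⟨_, (hunit _ _).symm.trans (congrArg (v.app _) (kellyNew_canon _ x).symm)⟩
    | inr h =>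
      obtain ⟨z⟩ := h
      obtain ⟨y, hs⟩ : ∃ y, v.app _ (kellyNew (𝟙 (T.ou c)) s) = y := ⟨_, rfl⟩
      rcases y with b | e
      · exact ⟨b, hs.symm⟩
      · have h₁ : v.app _ (((T.kellyCone c).obj Y).map (T.leg c z) (kellyNew (𝟙 _) s)) =
            ((sumFunctor F G).obj X).map (T.leg c z) (v.app _ (kellyNew (𝟙 (T.ou c)) s)) :=
          NatTrans.naturality_apply v _ _
        have h : kellyNew (𝟙 _ ≫ T.leg c z) s = _ :=
          (congrArg (fun t => kellyNew t s) (by simp)).trans (kellyNew_leg z (𝟙 _) s)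
        rw [hs, map_kellyNew, h, hunit] at h₁
        exact (Sum.inl_ne_inr h₁).elim
  have hall (d : D) (e : ((T.kellyCone c).obj Y).obj d) :
      ∃ b, ((sumInl F G).app X).app d b = v.app d e := by
    obtain ⟨x, rfl⟩ | ⟨t, s, rfl⟩ := kellyCone_cases e
    · exact ⟨_, (hunit d x).symm⟩
    · obtain ⟨b, hb⟩ := hnew s
      refine ⟨(F.obj X).map t b, ?_⟩
      rw [NatTrans.naturality_apply, NatTrans.naturality_apply, hb]
  choose b hb using hall
  refine ⟨{ app := fun d => TypeCat.ofHom (b d), naturality := fun d d' r => ?_ }, ?_⟩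
  · refine ConcreteCategory.hom_ext _ _ fun e => hinj d' ?_
    refine (hb _ _).trans ((NatTrans.naturality_apply v r e).trans ?_)
    rw [← hb]
    exact (NatTrans.naturality_apply ((sumInl F G).app X) r (b d e)).symm
  · exact NatTrans.type_ext hb

end LimitSketch

theorem theorem1p4 {D : Type w} [SmallCategory.{w} D] (T : LimitSketch.{w} D)
    [∀ c, FinCategory (T.Shape c)] :
    ∃ Z : T.EliminationData,
      -- `S_i(X)` is the coproduct `B_i(X) + E_i(X)`
      (∀ (i : ℕ) (X : D ⥤ Type w),
        Nonempty (IsColimit (BinaryCofan.mk ((Z.inl i).app X) ((Z.inr i).app X)))) ∧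
      -- `E_0(X)` is empty (and `Z.zeroIso` identifies `B_0(X)` with `X`)
      (∀ (X : D ⥤ Type w) (d : D), IsEmpty (((Z.E 0).obj X).obj d)) ∧
      -- `E_{i+1}(X)` is the left Kan extension of `c ↦ S_i(X)[c]` along `ou`
      (∀ (i : ℕ) (X : D ⥤ Type w),
        ((Z.E (i + 1)).obj X).IsLeftKanExtension (Z.kanUnit i X)) ∧
      -- `p_i` is the epimorphism that makes exactly the identifications (1) and (2)
      (∀ (i : ℕ) (X : D ⥤ Type w), Epi ((Z.p i).app X)) ∧
      (∀ (i : ℕ) (X : D ⥤ Type w) (d : D) (x y : ((Z.S i).obj X).obj d),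
        ((Z.p i).app X).app d x = ((Z.p i).app X).app d y ↔
          Relation.EqvGen (Z.Identifies i X d) x y) ∧
      -- the transfinite composite of the sequence is the reflector of `X`
      (∀ (X : D ⥤ Type w) (Q : Cocone (Z.chain X)), IsColimit Q →
        T.IsReflector (Z.unit.app X ≫ Q.ι.app 0)) ∧
      -- comparison with Kelly's sequence `X ⟶ P(X) ⟶ P²(X) ⟶ ⋯`
      (∃ α : ∀ i : ℕ, Z.S i ⟶ T.kellyPow i,
        Z.unit ≫ α 0 = 𝟙 (𝟭 (D ⥤ Type w)) ∧
        (∀ i : ℕ, Z.step i ≫ α (i + 1) = α i ≫ T.kellyStep i) ∧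
        (∀ (n : ℕ) (X : D ⥤ Type w) (c : T.K)
          (u : (T.kellyPow (n + 1)).obj X ⟶ (Z.S (n + 1)).obj X)
          (v : (T.kellyCone c).obj ((T.kellyPow (n + 1)).obj X) ⟶ (Z.S (n + 2)).obj X),
          u ≫ (α (n + 1)).app X = 𝟙 _ →
          (T.kellyConeUnit c).app ((T.kellyPow (n + 1)).obj X) ≫ v = u ≫ (Z.step (n + 1)).app X →
          v ≫ (α (n + 2)).app X = (T.kellyIncl c).app ((T.kellyPow (n + 1)).obj X) →
          ∃ v' : (T.kellyCone c).obj ((T.kellyPow (n + 1)).obj X) ⟶ (Z.B (n + 2)).obj X,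
            v' ≫ (Z.inl (n + 2)).app X = v)) := by
  refine ⟨T.elimination,
    fun _ _ => ⟨FunctorToTypes.binaryCoproductColimit _ _⟩,
    fun _ _ => inferInstanceAs (IsEmpty PEmpty),
    fun i X => LimitSketch.isLeftKanExtension_coneFree ((T.stage i).S.obj X),
    fun i X => inferInstanceAs (Epi (((T.stage i).total T).proj.app X)),
    fun i X d x y => ?_,
    fun X Q hQ => LimitSketch.isReflector_of_isColimit X hQ,
    fun i => (T.stageToKelly i).1, ?_, LimitSketch.stageStep_toKelly, ?_⟩
  · refine (NatRel.proj_eq_iff ((T.stage i).total T)).trans ?_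
    have h : ((T.stage i).total T).Rel X d = T.elimination.Identifies i X d :=
      funext₂ fun x y => propext (T.elimination_identifies i X d x y).symm
    rw [h]
    rfl
  · refine NatTrans.ext (funext fun X => ?_)
    rfl
  · intro n X c u v _ hv _
    refine LimitSketch.exists_factor_inl (fun _ => ?_) v (u ≫ ((T.stage (n + 1)).total T).proj.app X) hv
    obtain ⟨s, -⟩ := LimitSketch.exists_proj_eq (T := T) (c := c) (X := (T.kellyPow n).obj X)
      (fun z => isEmptyElim z) (fun z => isEmptyElim z)
    exact ⟨(LimitSketch.kellyFilling _).fill c s⟩
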